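/- Let $H$ be a complex Hilbert space, $T$ a bounded linear operator on $H$ and $0<\alpha\le 1$. For $\beta>0$ and $n\in\mathbb N_0$ put $$k^{\beta}(n)=\frac{\Gamma(\beta+n)}{\Gamma(\beta)\,\Gamma(n+1)}.$$ Suppose that $T$ is absolutely $(C,\alpha)$-Cesàro bounded, that is, there exists a constant $C>0$ such that $$\sup_{n\in\mathbb N_0}\frac{1}{k^{\alpha+1}(n)}\sum_{j=0}^{n}k^{\alpha}(n-j)\,\|T^{j}x\|\le C\|x\|\qquad\text{for all }x\in H.$$ Then $$\lim_{n\to\infty}\frac{\|T^{n}\|}{n^{\min\{\alpha,1/2\}}}=0.$$ -/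

import Mathlib

open Filter Topology

noncomputable section

/-- The Cesàro kernel `k^α(n) = Γ(α + n) / (Γ(α) Γ(n + 1))` of order `α > 0`. -/
def cesaroKernel (α : ℝ) (n : ℕ) : ℝ :=
  Real.Gamma (α + n) / (Real.Gamma α * Real.Gamma (n + 1))

/-- A bounded linear operator `T` is absolutely `(C, α)`-Cesàro bounded (`α > 0`) if there is a
constant `C > 0` such that, for every vector `x`, the supremum over `n ≥ 0` of the means
`k^{α+1}(n)⁻¹ ∑_{j=0}^n k^α(n - j) ‖T^j x‖` is at most `C ‖x‖`, i.e. each of them is. -/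
def IsAbsolutelyCesaroBounded {X : Type*} [NormedAddCommGroup X] [NormedSpace ℂ X]
    (α : ℝ) (T : X →L[ℂ] X) : Prop :=
  ∃ C : ℝ, 0 < C ∧ ∀ (x : X) (n : ℕ),
    1 / cesaroKernel (α + 1) n *
      ∑ j ∈ Finset.range (n + 1), cesaroKernel α (n - j) * ‖(T ^ j) x‖ ≤ C * ‖x‖

end

/-! Write `k^α` for `cesaroKernel α`. The exponent `α` comes from a Banach space argument: keeping
one term of the mean gives `‖T^n‖ ≤ C k^{α+1}(n) = O(n^α)`, and feeding this back through `‖T^n x‖ ≤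
‖T^{n-j}‖ ‖T^j x‖` gains a logarithm (`norm_pow_mul_sum_le`).

The exponent `1/2` needs the Hilbert space. Absolute `(C, α)`-boundedness implies the `(C, 1)`
version, which random signs turn into a square function estimate (`sum_sqrt_sum_norm_sq_le`). Tested
on the normalized orbit `T^j x / ‖T^j x‖`, it bounds `‖T^n‖ √(∑_{s ≤ n/2} q_s⁻²)` by a multiple of
`√(n+1)` whenever `‖T^s‖ ≤ q_s` (`norm_pow_mul_sqrt_le`). A first use gives `‖T^n‖ = O(√n)`; with
that as `q`, the sum diverges like `log n`, and `O` becomes `o`. -/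

/-! ### Cesàro kernels -/

theorem cesaroKernel_pos {β : ℝ} (hβ : 0 < β) (n : ℕ) : 0 < cesaroKernel β n := by
  unfold cesaroKernel
  have h1 : 0 < Real.Gamma (β + n) := Real.Gamma_pos_of_pos (by positivity)
  have h2 : 0 < Real.Gamma ((n : ℝ) + 1) := Real.Gamma_pos_of_pos (by positivity)
  have h3 := Real.Gamma_pos_of_pos hβ
  positivity

theorem cesaroKernel_zero {β : ℝ} (hβ : 0 < β) : cesaroKernel β 0 = 1 := by
  have h3 := (Real.Gamma_pos_of_pos hβ).ne'
  simp [cesaroKernel, h3]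

theorem cesaroKernel_succ {β : ℝ} (hβ : 0 < β) (n : ℕ) :
    cesaroKernel β (n + 1) = cesaroKernel β n * ((β + n) / (n + 1)) := by
  have h1 : Real.Gamma (β + n + 1) = (β + n) * Real.Gamma (β + n) :=
    Real.Gamma_add_one (by positivity)
  have h2 : Real.Gamma ((n : ℝ) + 1 + 1) = (n + 1) * Real.Gamma ((n : ℝ) + 1) :=
    Real.Gamma_add_one (by positivity)
  have h3 := (Real.Gamma_pos_of_pos hβ).ne'
  have h4 : Real.Gamma ((n : ℝ) + 1) ≠ 0 := (Real.Gamma_pos_of_pos (by positivity)).ne'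
  unfold cesaroKernel
  push_cast
  rw [← add_assoc, h1, h2]
  field_simp

theorem cesaroKernel_eq_mul_cesaroKernel_add_one {α : ℝ} (hα : 0 < α) (n : ℕ) :
    cesaroKernel α n = α / (α + n) * cesaroKernel (α + 1) n := by
  have h1 : Real.Gamma (α + n + 1) = (α + n) * Real.Gamma (α + n) :=
    Real.Gamma_add_one (by positivity)
  have h2 : Real.Gamma (α + 1) = α * Real.Gamma α := Real.Gamma_add_one hα.ne'
  have h3 := (Real.Gamma_pos_of_pos hα).ne'
  have h4 : Real.Gamma ((n : ℝ) + 1) ≠ 0 := (Real.Gamma_pos_of_pos (by positivity)).ne'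
  unfold cesaroKernel
  rw [add_right_comm, h1, h2]
  field_simp

theorem cesaroKernel_antitone {α : ℝ} (hα0 : 0 < α) (hα1 : α ≤ 1) :
    Antitone (cesaroKernel α) := by
  refine antitone_nat_of_succ_le fun n => ?_
  rw [cesaroKernel_succ hα0]
  refine mul_le_of_le_one_right (cesaroKernel_pos hα0 n).le ?_
  rw [div_le_one (by positivity)]
  linarith

/-- The kernel of order `α + 1` grows at most like `n ^ α`. -/
theorem cesaroKernel_add_one_succ_le {α : ℝ} (hα0 : 0 < α) (hα1 : α ≤ 1) (n : ℕ) :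
    cesaroKernel (α + 1) (n + 1) ≤ (α + 1) * ((n : ℝ) + 1) ^ α := by
  induction n with
  | zero => simp [cesaroKernel_succ (add_pos hα0 one_pos), cesaroKernel_zero (add_pos hα0 one_pos)]
  | succ n ih =>
    rw [cesaroKernel_succ (add_pos hα0 one_pos)]
    have hn : (0 : ℝ) < n + 2 := by positivity
    -- Bernoulli's inequality; the induction then closes by `(1 - y)(1 + y) ≤ 1` with `y = α / (n +
    -- 2)`.
    have hB : (((n : ℝ) + 1) / (n + 2)) ^ α ≤ 1 - α / (n + 2) := by
      have := rpow_one_add_le_one_add_mul_self (s := -1 / ((n : ℝ) + 2))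
        (by rw [le_div_iff₀ hn]; linarith [(Nat.cast_nonneg n : (0 : ℝ) ≤ n)]) hα0.le hα1
      convert this using 2 <;> field_simp <;> ring
    rw [Real.div_rpow (by positivity) hn.le] at hB
    have hp : (0 : ℝ) < ((n : ℝ) + 2) ^ α := by positivity
    have hq : (α + 1 + ((n + 1 : ℕ) : ℝ)) / ((n + 1 : ℕ) + 1) = 1 + α / (n + 2) := by
      push_cast
      field_simp
      ring
    have hc : ((n + 1 : ℕ) : ℝ) + 1 = n + 2 := by push_cast; ring
    rw [hq, hc]
    rw [div_le_iff₀ hp] at hB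
    have hd : 0 < α / ((n : ℝ) + 2) := by positivity
    calc cesaroKernel (α + 1) (n + 1) * (1 + α / (n + 2))
        ≤ (α + 1) * ((n : ℝ) + 1) ^ α * (1 + α / (n + 2)) := by gcongr
      _ ≤ (α + 1) * ((1 - α / (n + 2)) * (n + 2) ^ α) * (1 + α / (n + 2)) := by gcongr
      _ = (α + 1) * ((n : ℝ) + 2) ^ α * (1 - (α / (n + 2)) ^ 2) := by ring
      _ ≤ (α + 1) * ((n : ℝ) + 2) ^ α :=
        mul_le_of_le_one_right (by positivity) (by nlinarith)

/-! ### Estimates valid in every normed space -/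

section Banach

variable {X : Type*} [NormedAddCommGroup X] [NormedSpace ℂ X]

theorem norm_pow_apply_le {T : X →L[ℂ] X} {s j n : ℕ} (h : s + j = n) (x : X) :
    ‖(T ^ n) x‖ ≤ ‖T ^ s‖ * ‖(T ^ j) x‖ := by
  rw [← h, pow_add]
  exact (T ^ s).le_opNorm _

theorem sum_cesaroKernel_mul_norm_le {α C : ℝ} (hα0 : 0 < α) {T : X →L[ℂ] X}
    (hT : ∀ (x : X) (n : ℕ), 1 / cesaroKernel (α + 1) n *
      ∑ j ∈ Finset.range (n + 1), cesaroKernel α (n - j) * ‖(T ^ j) x‖ ≤ C * ‖x‖)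
    (x : X) (n : ℕ) :
    ∑ j ∈ Finset.range (n + 1), cesaroKernel α (n - j) * ‖(T ^ j) x‖
      ≤ C * cesaroKernel (α + 1) n * ‖x‖ := by
  have h := hT x n
  rw [one_div, inv_mul_le_iff₀ (cesaroKernel_pos (by positivity) n)] at h
  linarith

theorem norm_pow_le_cesaroKernel {α C : ℝ} (hα0 : 0 < α) (hC : 0 < C) {T : X →L[ℂ] X}
    (hT : ∀ (x : X) (n : ℕ), ∑ j ∈ Finset.range (n + 1), cesaroKernel α (n - j) * ‖(T ^ j) x‖
      ≤ C * cesaroKernel (α + 1) n * ‖x‖) (n : ℕ) :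
    ‖T ^ n‖ ≤ C * cesaroKernel (α + 1) n := by
  have hk := cesaroKernel_pos (add_pos hα0 one_pos) n
  refine ContinuousLinearMap.opNorm_le_bound _ (by positivity) fun x => ?_
  refine le_trans ?_ (hT x n)
  have := Finset.single_le_sum (f := fun j => cesaroKernel α (n - j) * ‖(T ^ j) x‖)
    (fun j _ => mul_nonneg (cesaroKernel_pos hα0 _).le (norm_nonneg _))
    (Finset.self_mem_range_succ n)
  simpa [cesaroKernel_zero hα0] using this

/-- The bound `‖T^{n-j}‖ ≤ C k^{α+1}(n-j)` is used for every `j`. Since `k^α(m) = α/(α+m) ·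
k^{α+1}(m)`, the weights `α/(α+m)` turn the result into the Cesàro sum itself; their sum diverges,
which is the gain. -/
theorem norm_pow_mul_sum_le {α C : ℝ} (hα0 : 0 < α) (hC : 0 < C) {T : X →L[ℂ] X}
    (hT : ∀ (x : X) (n : ℕ), ∑ j ∈ Finset.range (n + 1), cesaroKernel α (n - j) * ‖(T ^ j) x‖
      ≤ C * cesaroKernel (α + 1) n * ‖x‖) (n : ℕ) :
    ‖T ^ n‖ * ∑ m ∈ Finset.range (n + 1), α / (α + m) ≤ C ^ 2 * cesaroKernel (α + 1) n := by
  have hk := cesaroKernel_pos (add_pos hα0 one_pos)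
  have hS : 0 < ∑ m ∈ Finset.range (n + 1), α / (α + m) :=
    Finset.sum_pos (fun m _ => by positivity) ⟨0, by simp⟩
  rw [← le_div_iff₀ hS]
  refine ContinuousLinearMap.opNorm_le_bound _
    (div_nonneg (mul_nonneg (sq_nonneg C) (hk n).le) hS.le) fun x => ?_
  rw [div_mul_eq_mul_div, le_div_iff₀ hS]
  have key : ∑ m ∈ Finset.range (n + 1), ‖(T ^ n) x‖ * (α / (α + m))
      ≤ C * ∑ j ∈ Finset.range (n + 1), cesaroKernel α (n - j) * ‖(T ^ j) x‖ := by
    rw [← Finset.sum_range_reflect, Finset.mul_sum]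
    refine Finset.sum_le_sum fun j hj => ?_
    have hj' : n + 1 - 1 - j + j = n := by have := Finset.mem_range.1 hj; omega
    have e : n + 1 - 1 - j = n - j := by omega
    rw [e] at hj' ⊢
    have h1 := norm_pow_apply_le (T := T) hj' x
    have h2 := norm_pow_le_cesaroKernel hα0 hC hT (n - j)
    rw [cesaroKernel_eq_mul_cesaroKernel_add_one hα0]
    calc ‖(T ^ n) x‖ * (α / (α + (n - j : ℕ)))
        ≤ (C * cesaroKernel (α + 1) (n - j) * ‖(T ^ j) x‖) * (α / (α + (n - j : ℕ))) := by
          gcongr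
          exact h1.trans (by gcongr)
      _ = _ := by ring
  rw [Finset.mul_sum]
  calc _ ≤ _ := key
    _ ≤ C * (C * cesaroKernel (α + 1) n * ‖x‖) := by gcongr; exact hT x n
    _ = _ := by ring

theorem tendsto_sum_div_add_atTop {α : ℝ} (hα0 : 0 < α) (hα1 : α ≤ 1) :
    Tendsto (fun n : ℕ => ∑ m ∈ Finset.range (n + 1), α / (α + m)) atTop atTop := by
  have h := (Real.tendsto_sum_range_one_div_nat_succ_atTop.comp
    (tendsto_add_atTop_nat 1)).const_mul_atTop hα0
  refine tendsto_atTop_mono (fun n => ?_) h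
  simp only [Function.comp_apply, Finset.mul_sum]
  refine Finset.sum_le_sum fun m _ => ?_
  rw [mul_one_div]
  exact div_le_div_of_nonneg_left hα0.le (by positivity) (by linarith)

theorem tendsto_norm_pow_div_rpow {α C : ℝ} (hα0 : 0 < α) (hα1 : α ≤ 1) (hC : 0 < C)
    {T : X →L[ℂ] X}
    (hT : ∀ (x : X) (n : ℕ), ∑ j ∈ Finset.range (n + 1), cesaroKernel α (n - j) * ‖(T ^ j) x‖
      ≤ C * cesaroKernel (α + 1) n * ‖x‖) :
    Tendsto (fun n : ℕ => ‖T ^ n‖ / (n : ℝ) ^ α) atTop (𝓝 0) := by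
  have hlim := (tendsto_sum_div_add_atTop hα0 hα1).const_div_atTop (C ^ 2 * (α + 1))
  refine squeeze_zero' (Eventually.of_forall fun n => by positivity) ?_ hlim
  filter_upwards [eventually_ge_atTop 1] with n hn
  obtain ⟨m, rfl⟩ := Nat.exists_eq_add_of_le' hn
  have hS : 0 < ∑ i ∈ Finset.range (m + 1 + 1), α / (α + i) :=
    Finset.sum_pos (fun m _ => by positivity) ⟨0, by simp⟩
  have hp : 0 < ((m + 1 : ℕ) : ℝ) ^ α := by positivity
  rw [div_le_div_iff₀ hp hS]
  have h1 := cesaroKernel_add_one_succ_le hα0 hα1 m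
  calc _ ≤ _ := norm_pow_mul_sum_le hα0 hC hT (m + 1)
    _ ≤ C ^ 2 * ((α + 1) * ((m : ℝ) + 1) ^ α) := by gcongr
    _ = _ := by push_cast; ring

/-- For `α ≤ 1`, absolute `(C, α)`-boundedness implies absolute `(C, 1)`-boundedness. -/
theorem sum_norm_pow_apply_le {α C : ℝ} (hα0 : 0 < α) (hα1 : α ≤ 1) (hC : 0 < C) {T : X →L[ℂ] X}
    (hT : ∀ (x : X) (n : ℕ), ∑ j ∈ Finset.range (n + 1), cesaroKernel α (n - j) * ‖(T ^ j) x‖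
      ≤ C * cesaroKernel (α + 1) n * ‖x‖) (x : X) (n : ℕ) :
    ∑ j ∈ Finset.range (n + 1), ‖(T ^ j) x‖ ≤ C / α * (n + 1) * ‖x‖ := by
  have hk := cesaroKernel_pos (add_pos hα0 one_pos) n
  have h1 : cesaroKernel α n * ∑ j ∈ Finset.range (n + 1), ‖(T ^ j) x‖
      ≤ C * cesaroKernel (α + 1) n * ‖x‖ := by
    refine le_trans ?_ (hT x n)
    rw [Finset.mul_sum]
    gcongr with j
    exact cesaroKernel_antitone hα0 hα1 (Nat.sub_le n j)
  -- The ratio `k^{α+1}(n) / k^α(n) = (α + n)/α` is at most `(n + 1)/α`, hence the constant `C / α`.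
  rw [cesaroKernel_eq_mul_cesaroKernel_add_one hα0] at h1
  have h2 : α / (α + n) * ∑ j ∈ Finset.range (n + 1), ‖(T ^ j) x‖ ≤ C * ‖x‖ :=
    le_of_mul_le_mul_left (by linarith) hk
  rw [div_mul_eq_mul_div, div_le_iff₀ (by positivity)] at h2
  rw [div_mul_eq_mul_div, div_mul_eq_mul_div, le_div_iff₀ hα0]
  have : C * ‖x‖ * (α + n) ≤ C * ‖x‖ * (n + 1) := by gcongr C * ‖x‖ * ?_; linarith
  linarith

end Banach

/-! ### Rademacher averages and Khinchine's inequality -/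

section SignAverage

/-- The average of `F (∑ j < n, ε j • v j)` over all choices of signs `ε j = ±1`. -/
noncomputable def signAverage {E : Type*} [AddCommGroup E] (v : ℕ → E) : ℕ → (E → ℝ) → ℝ
  | 0, F => F 0
  | n + 1, F => (signAverage v n (fun a => F (a + v n)) + signAverage v n (fun a => F (a - v n))) / 2

section Group

variable {E : Type*} [AddCommGroup E] (v : ℕ → E)

theorem signAverage_mono (n : ℕ) {F G : E → ℝ} (h : ∀ a, F a ≤ G a) :
    signAverage v n F ≤ signAverage v n G := by
  induction n generalizing F G with
  | zero => exact h 0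
  | succ n ih =>
    simp only [signAverage]
    linarith [ih (F := fun a => F (a + v n)) (G := fun a => G (a + v n)) fun a => h _,
      ih (F := fun a => F (a - v n)) (G := fun a => G (a - v n)) fun a => h _]

theorem signAverage_add (n : ℕ) (F G : E → ℝ) :
    signAverage v n (fun a => F a + G a) = signAverage v n F + signAverage v n G := by
  induction n generalizing F G with
  | zero => rfl
  | succ n ih =>
    simp only [signAverage]
    rw [ih (fun a => F (a + v n)), ih (fun a => F (a - v n))]
    ring

theorem signAverage_const_mul (n : ℕ) (c : ℝ) (F : E → ℝ) :
    signAverage v n (fun a => c * F a) = c * signAverage v n F := by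
  induction n generalizing F with
  | zero => rfl
  | succ n ih =>
    simp only [signAverage]
    rw [ih (fun a => F (a + v n)), ih (fun a => F (a - v n))]
    ring

theorem signAverage_const (n : ℕ) (c : ℝ) : signAverage v n (fun _ => c) = c := by
  induction n with
  | zero => rfl
  | succ n ih => simp [signAverage, ih]

theorem signAverage_sum {ι : Type*} (s : Finset ι) (n : ℕ) (F : ι → E → ℝ) :
    signAverage v n (fun a => ∑ i ∈ s, F i a) = ∑ i ∈ s, signAverage v n (F i) := by
  classical
  induction s using Finset.induction_on with
  | empty => simpa using signAverage_const v n 0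
  | insert i s hi ih =>
    simp only [Finset.sum_insert hi]
    rw [signAverage_add, ih]

theorem signAverage_comp_map {E' : Type*} [AddCommGroup E'] (f : E →+ E') (n : ℕ) (F : E' → ℝ) :
    signAverage v n (fun a => F (f a)) = signAverage (fun j => f (v j)) n F := by
  induction n generalizing F with
  | zero => simp [signAverage]
  | succ n ih =>
    simp only [signAverage, map_add, map_sub]
    rw [ih (fun a => F (a + f (v n))), ih (fun a => F (a - f (v n)))]

end Group

variable {H : Type*} [NormedAddCommGroup H] [InnerProductSpace ℂ H] (v : ℕ → H)

theorem signAverage_norm_sq (n : ℕ) :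
    signAverage v n (fun a => ‖a‖ ^ 2) = ∑ j ∈ Finset.range n, ‖v j‖ ^ 2 := by
  induction n with
  | zero => simp [signAverage]
  | succ n ih =>
    have h : ∀ a, ‖a + v n‖ ^ 2 + ‖a - v n‖ ^ 2 = 2 * ‖a‖ ^ 2 + 2 * ‖v n‖ ^ 2 := fun a => by
      rw [norm_add_sq (𝕜 := ℂ), norm_sub_sq (𝕜 := ℂ)]
      ring
    simp only [signAverage]
    rw [← signAverage_add]
    simp only [h]
    rw [signAverage_add, signAverage_const, signAverage_const_mul, ih, Finset.sum_range_succ]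
    ring

/-- The fourth moment of a Rademacher sum is at most three times the squared second moment. -/
theorem signAverage_norm_pow_four_le (n : ℕ) :
    signAverage v n (fun a => ‖a‖ ^ 4) ≤ 3 * (∑ j ∈ Finset.range n, ‖v j‖ ^ 2) ^ 2 := by
  induction n with
  | zero => simp [signAverage]
  | succ n ih =>
    have h : ∀ a, ‖a + v n‖ ^ 4 + ‖a - v n‖ ^ 4
        ≤ 2 * ‖a‖ ^ 4 + 12 * ‖v n‖ ^ 2 * ‖a‖ ^ 2 + 2 * ‖v n‖ ^ 4 := fun a => by
      have e1 := norm_add_sq (𝕜 := ℂ) a (v n)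
      have e2 := norm_sub_sq (𝕜 := ℂ) a (v n)
      have e3 : (RCLike.re (inner ℂ a (v n))) ^ 2 ≤ (‖a‖ * ‖v n‖) ^ 2 :=
        sq_le_sq.2 (by
          rw [abs_of_nonneg (by positivity : 0 ≤ ‖a‖ * ‖v n‖)]
          exact (RCLike.abs_re_le_norm _).trans (norm_inner_le_norm _ _))
      have f1 : ‖a + v n‖ ^ 4 = (‖a + v n‖ ^ 2) ^ 2 := by ring
      have f2 : ‖a - v n‖ ^ 4 = (‖a - v n‖ ^ 2) ^ 2 := by ring
      rw [f1, f2, e1, e2]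
      nlinarith
    simp only [signAverage]
    rw [← signAverage_add]
    have h2 := signAverage_mono v n h
    rw [signAverage_add, signAverage_add, signAverage_add, signAverage_const,
      signAverage_const_mul, signAverage_const_mul, signAverage_norm_sq] at h2
    rw [signAverage_add, Finset.sum_range_succ]
    have := sq_nonneg (‖v n‖ ^ 2)
    nlinarith

theorem signAverage_norm_le (n : ℕ) :
    signAverage v n (fun a => ‖a‖) ≤ √(∑ j ∈ Finset.range n, ‖v j‖ ^ 2) := by
  set M := ∑ j ∈ Finset.range n, ‖v j‖ ^ 2 with hM
  have hM0 : 0 ≤ M := by positivity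
  rcases hM0.eq_or_lt with h0 | h0
  -- The weight `1 / (2√M)` of the main case degenerates here, so a free `ε` replaces `√M / 2`.
  · have hs : ∀ ε > 0, signAverage v n (fun a => ‖a‖) ≤ ε := fun ε hε => by
      have := signAverage_mono v n (F := fun a => ‖a‖) (G := fun a => 1 / (4 * ε) * ‖a‖ ^ 2 + ε)
        fun a => by
          have : 1 / (4 * ε) * ‖a‖ ^ 2 + ε - ‖a‖ = (‖a‖ - 2 * ε) ^ 2 / (4 * ε) := by
            field_simp; ring
          have h2 : 0 ≤ (‖a‖ - 2 * ε) ^ 2 / (4 * ε) := by positivity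
          linarith
      rw [signAverage_add, signAverage_const, signAverage_const_mul, signAverage_norm_sq, ← hM,
        ← h0] at this
      linarith
    rw [← h0, Real.sqrt_zero]
    exact le_of_forall_pos_le_add fun ε hε => by simpa using hs ε hε
  · have hm : 0 < √M := Real.sqrt_pos.2 h0
    have := signAverage_mono v n (F := fun a => ‖a‖)
      (G := fun a => 1 / (2 * √M) * ‖a‖ ^ 2 + √M / 2) fun a => by
        have : 1 / (2 * √M) * ‖a‖ ^ 2 + √M / 2 - ‖a‖ = (‖a‖ - √M) ^ 2 / (2 * √M) := by
          field_simp; ring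
        have h2 : 0 ≤ (‖a‖ - √M) ^ 2 / (2 * √M) := by positivity
        linarith
    rw [signAverage_add, signAverage_const, signAverage_const_mul, signAverage_norm_sq, ← hM] at this
    have e : 1 / (2 * √M) * M = √M / 2 := by
      field_simp
      exact (Real.sq_sqrt hM0).symm
    linarith

/-- Khinchine's lower bound for Rademacher sums in a Hilbert space. -/
theorem le_signAverage_norm (n : ℕ) :
    5 / 9 * √(∑ j ∈ Finset.range n, ‖v j‖ ^ 2) ≤ signAverage v n (fun a => ‖a‖) := by
  set M := ∑ j ∈ Finset.range n, ‖v j‖ ^ 2 with hM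
  have hM0 : 0 ≤ M := by positivity
  rcases hM0.eq_or_lt with h0 | h0
  · have := signAverage_mono v n (F := fun _ => 0) (G := fun a => ‖a‖) fun a => norm_nonneg a
    rw [signAverage_const] at this
    simpa [← h0] using this
  · have hm : 0 < √M := Real.sqrt_pos.2 h0
    set m := √M
    have hmM : m ^ 2 = M := Real.sq_sqrt hM0
    -- `4/27` is the least constant for which this holds pointwise, with equality at `‖a‖ = 3m/2`.
    -- The fourth moment bound `3m⁴` then leaves `m - (4/9)m = (5/9)m`.
    have := signAverage_mono v n (G := fun a => ‖a‖ + 4 / (27 * m ^ 3) * ‖a‖ ^ 4)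
      (F := fun a => 1 / m * ‖a‖ ^ 2) fun a => by
        have : ‖a‖ + 4 / (27 * m ^ 3) * ‖a‖ ^ 4 - 1 / m * ‖a‖ ^ 2
            = ‖a‖ * ((2 * ‖a‖ - 3 * m) ^ 2 * (‖a‖ + 3 * m)) / (27 * m ^ 3) := by
          field_simp; ring
        have h2 : 0 ≤ ‖a‖ * ((2 * ‖a‖ - 3 * m) ^ 2 * (‖a‖ + 3 * m)) / (27 * m ^ 3) := by positivity
        linarith
    rw [signAverage_add, signAverage_const_mul, signAverage_const_mul, signAverage_norm_sq, ← hM,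
      ← hmM] at this
    have h4 := signAverage_norm_pow_four_le v n
    rw [← hM, ← hmM] at h4
    have h5 : 4 / (27 * m ^ 3) * signAverage v n (fun a => ‖a‖ ^ 4)
        ≤ 4 / (27 * m ^ 3) * (3 * (m ^ 2) ^ 2) := by gcongr
    have e1 : 1 / m * m ^ 2 = m := by field_simp
    have e2 : 4 / (27 * m ^ 3) * (3 * (m ^ 2) ^ 2) = 4 / 9 * m := by field_simp; norm_num
    linarith

end SignAverage

/-! ### Square function estimate and growth of powers in Hilbert space -/

section Hilbert

variable {H : Type*} [NormedAddCommGroup H] [InnerProductSpace ℂ H] {T : H →L[ℂ] H} {C : ℝ}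

/-- The square-function form of absolute Cesàro boundedness. -/
theorem sum_sqrt_sum_norm_sq_le (hC : 0 < C)
    (hT : ∀ (x : H) (n : ℕ), ∑ i ∈ Finset.range (n + 1), ‖(T ^ i) x‖ ≤ C * (n + 1) * ‖x‖)
    (v : ℕ → H) (m n : ℕ) :
    ∑ i ∈ Finset.range (n + 1), √(∑ j ∈ Finset.range m, ‖(T ^ i) (v j)‖ ^ 2)
      ≤ 9 / 5 * (C * (n + 1) * √(∑ j ∈ Finset.range m, ‖v j‖ ^ 2)) := by
  -- The hypothesis is applied to each signed sum `∑ ± v j` and averaged; Khinchine bounds both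
  -- sides.
  have h1 := signAverage_mono v m fun a => hT a n
  rw [signAverage_sum, signAverage_const_mul] at h1
  have h2 : ∑ i ∈ Finset.range (n + 1), 5 / 9 * √(∑ j ∈ Finset.range m, ‖(T ^ i) (v j)‖ ^ 2)
      ≤ ∑ i ∈ Finset.range (n + 1), signAverage v m (fun a => ‖(T ^ i) a‖) :=
    Finset.sum_le_sum fun i _ => by
      have e := signAverage_comp_map v ((T ^ i : H →L[ℂ] H) : H →ₗ[ℂ] H).toAddMonoidHom m
        (fun a => ‖a‖)
      exact (le_signAverage_norm (fun j => (T ^ i) (v j)) m).trans_eq e.symm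
  rw [← Finset.mul_sum] at h2
  have h3 : C * (n + 1) * signAverage v m (fun a => ‖a‖)
      ≤ C * (n + 1) * √(∑ j ∈ Finset.range m, ‖v j‖ ^ 2) := by
    gcongr
    exact signAverage_norm_le v m
  linarith

theorem sq_le_sum_mul_sum_inv {b : ℕ → ℝ} {m : ℕ} (hb : ∀ i < m, 0 < b i) :
    (m : ℝ) ^ 2 ≤ (∑ i ∈ Finset.range m, b i) * ∑ i ∈ Finset.range m, 1 / b i := by
  have h := Finset.sum_sq_le_sum_mul_sum_of_sq_le_mul (Finset.range m) (r := fun _ => (1 : ℝ))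
    (f := b) (g := fun i => 1 / b i) (fun i hi => (hb i (Finset.mem_range.1 hi)).le)
    (fun i hi => (one_div_pos.2 (hb i (Finset.mem_range.1 hi))).le)
    (fun i hi => by 
      rw [mul_one_div_cancel (hb i (Finset.mem_range.1 hi)).ne', one_pow])
  simpa using h

/-- With `b j = ‖T^j x‖`, only the entries `j = n - s - i`, `s, i ≤ n/2`, of the square function are
kept. There `‖T^i v_j‖ = b (n - s) / b j ≥ b n / (q s · b j)`, and Cauchy–Schwarz with weights `1 /
q s ^ 2` makes the bound linear in `1 / b j`, so that the sum over `i` can be taken. The constant is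
`4 · 9/5`. -/
theorem norm_pow_apply_mul_sqrt_le (hC : 0 < C)
    (hT : ∀ (x : H) (n : ℕ), ∑ i ∈ Finset.range (n + 1), ‖(T ^ i) x‖ ≤ C * (n + 1) * ‖x‖)
    {q : ℕ → ℝ} (hq : ∀ s, 0 < q s) (hTq : ∀ s, ‖T ^ s‖ ≤ q s) (n : ℕ) (x : H) :
    ‖(T ^ n) x‖ * √(∑ s ∈ Finset.range (n / 2 + 1), 1 / q s ^ 2)
      ≤ 36 / 5 * C ^ 2 * √((n : ℝ) + 1) * ‖x‖ := by
  rcases eq_or_ne ((T ^ n) x) 0 with h0 | h0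
  · rw [h0]
    simp only [norm_zero, zero_mul]
    positivity
  set M := n / 2 with hM
  have hMn : (n : ℝ) + 1 ≤ 2 * (M + 1) := by
    have : n + 1 ≤ 2 * (M + 1) := by omega
    exact_mod_cast this
  set b : ℕ → ℝ := fun j => ‖(T ^ j) x‖ with hb
  have hbn : 0 < b n := norm_pos_iff.2 h0
  have hbj : ∀ j ≤ n, 0 < b j := fun j hj => by
    refine norm_pos_iff.2 fun h => h0 ?_
    have := norm_pow_apply_le (T := T) (Nat.sub_add_cancel hj) x
    rw [h, norm_zero, mul_zero] at this
    exact norm_le_zero_iff.1 this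
  have hx : 0 < ‖x‖ := by simpa [hb] using hbj 0 (Nat.zero_le _)
  set W := ∑ s ∈ Finset.range (M + 1), 1 / q s ^ 2 with hW
  have hW0 : 0 < W := Finset.sum_pos (fun s _ => by have := hq s; positivity) ⟨0, by simp⟩
  have hqb : ∀ s ≤ n, b n / q s ≤ b (n - s) := fun s hs => by
    rw [div_le_iff₀ (hq s), mul_comm]
    exact (norm_pow_apply_le (T := T) (Nat.add_sub_cancel' hs) x).trans (by gcongr; exact hTq s)
  let v : ℕ → H := fun j => ((b j)⁻¹ : ℂ) • (T ^ j) x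
  have hv : ∀ i, ∀ j ≤ n, ‖(T ^ i) (v j)‖ = b (i + j) / b j := fun i j hj => by
    have : (T ^ i) ((T ^ j) x) = (T ^ (i + j)) x := by rw [pow_add]; rfl
    simp only [v, map_smul, this, norm_smul, norm_inv, Complex.norm_real, Real.norm_eq_abs,
      abs_of_pos (hbj j hj)]
    rw [inv_mul_eq_div]
  have hmain := sum_sqrt_sum_norm_sq_le hC hT v (n + 1) n
  have hv1 : ∑ j ∈ Finset.range (n + 1), ‖v j‖ ^ 2 = (n : ℝ) + 1 := by
    have h1 : ∀ j ∈ Finset.range (n + 1), ‖v j‖ ^ 2 = 1 := fun j hj => by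
      have hj' := Nat.lt_succ_iff.1 (Finset.mem_range.1 hj)
      have := hv 0 j hj'
      rw [pow_zero, zero_add, div_self (hbj j hj').ne'] at this
      change ‖v j‖ = 1 at this
      rw [this, one_pow]
    rw [Finset.sum_congr rfl h1]
    simp
  rw [hv1] at hmain
  -- the square function dominates a weighted mean of `1 / b`
  have hlow : ∀ i ∈ Finset.range (M + 1),
      b n / √W * ∑ s ∈ Finset.range (M + 1), 1 / q s ^ 2 * (1 / b (n - s - i))
        ≤ √(∑ j ∈ Finset.range (n + 1), ‖(T ^ i) (v j)‖ ^ 2) := fun i hi => by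
    have hi' := Finset.mem_range.1 hi
    have hA : ∑ s ∈ Finset.range (M + 1), 1 / q s ^ 2 * (b n / b (n - s - i)) ^ 2
        ≤ ∑ j ∈ Finset.range (n + 1), ‖(T ^ i) (v j)‖ ^ 2 := by
      -- As `s, i ≤ n / 2`, the natural subtraction never truncates.
      have hinj : Set.InjOn (fun s => n - s - i) (Finset.range (M + 1) : Finset ℕ) := by
        intro s hs t ht hst
        have hs' := Finset.mem_range.1 hs
        have ht' := Finset.mem_range.1 ht
        simp only at hst
        omega
      calc _ ≤ ∑ s ∈ Finset.range (M + 1), ‖(T ^ i) (v (n - s - i))‖ ^ 2 := by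
            refine Finset.sum_le_sum fun s hs => ?_
            have hs' := Finset.mem_range.1 hs
            rw [hv i _ (by omega), show i + (n - s - i) = n - s by omega]
            have hpos := hbj (n - s - i) (by omega)
            have hqs := hq s
            have := hqb s (by omega)
            calc 1 / q s ^ 2 * (b n / b (n - s - i)) ^ 2
                = (b n / q s / b (n - s - i)) ^ 2 := by field_simp
              _ ≤ _ := by gcongr
        _ = ∑ j ∈ (Finset.range (M + 1)).image (fun s => n - s - i), ‖(T ^ i) (v j)‖ ^ 2 :=
            (Finset.sum_image (f := fun j => ‖(T ^ i) (v j)‖ ^ 2) hinj).symm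
        _ ≤ _ := by
            refine Finset.sum_le_sum_of_subset_of_nonneg ?_ fun _ _ _ => by positivity
            intro j hj
            obtain ⟨s, _, rfl⟩ := Finset.mem_image.1 hj
            exact Finset.mem_range.2 (by omega)
    have hB : (∑ s ∈ Finset.range (M + 1), 1 / q s ^ 2 * (b n / b (n - s - i))) ^ 2
        ≤ W * ∑ s ∈ Finset.range (M + 1), 1 / q s ^ 2 * (b n / b (n - s - i)) ^ 2 :=
      Finset.sum_sq_le_sum_mul_sum_of_sq_le_mul _ (fun s _ => by positivity)
        (fun s _ => by positivity) fun s _ => le_of_eq (by ring)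
    refine Real.le_sqrt_of_sq_le (le_trans ?_ hA)
    have e : b n / √W * ∑ s ∈ Finset.range (M + 1), 1 / q s ^ 2 * (1 / b (n - s - i))
        = (∑ s ∈ Finset.range (M + 1), 1 / q s ^ 2 * (b n / b (n - s - i))) / √W := by
      rw [Finset.mul_sum, Finset.sum_div]
      exact Finset.sum_congr rfl fun s _ => by ring
    rw [e, div_pow, Real.sq_sqrt hW0.le, div_le_iff₀ hW0]
    linarith
  -- the harmonic-arithmetic mean inequality on each block
  have hinv : ∀ s ∈ Finset.range (M + 1),
      ((n : ℝ) + 1) / (4 * C * ‖x‖) ≤ ∑ i ∈ Finset.range (M + 1), 1 / b (n - s - i) := fun s hs => by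
    have hs' := Finset.mem_range.1 hs
    have h1 := sq_le_sum_mul_sum_inv (b := fun i => b (n - s - i)) (m := M + 1)
      fun i hi => hbj _ (by omega)
    have hinj : Set.InjOn (fun i => n - s - i) (Finset.range (M + 1) : Finset ℕ) := by
      intro i hi t ht hst
      have hi' := Finset.mem_range.1 hi
      have ht' := Finset.mem_range.1 ht
      simp only at hst
      omega
    have h2 : ∑ i ∈ Finset.range (M + 1), b (n - s - i) ≤ C * (n + 1) * ‖x‖ := by
      refine le_trans ?_ (hT x n)
      rw [← Finset.sum_image (f := b) hinj]
      refine Finset.sum_le_sum_of_subset_of_nonneg ?_ fun _ _ _ => by positivity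
      intro j hj
      obtain ⟨i, _, rfl⟩ := Finset.mem_image.1 hj
      exact Finset.mem_range.2 (by omega)
    have h3 : 0 ≤ ∑ i ∈ Finset.range (M + 1), 1 / b (n - s - i) :=
      Finset.sum_nonneg fun i _ => by positivity
    have h4 := h1.trans (mul_le_mul_of_nonneg_right h2 h3)
    rw [div_le_iff₀ (by positivity)]
    have h5 : ((n : ℝ) + 1) ^ 2 ≤ 4 * ((M + 1 : ℕ) : ℝ) ^ 2 := by
      push_cast
      nlinarith [(Nat.cast_nonneg n : (0 : ℝ) ≤ n)]
    have hn : (0 : ℝ) < n + 1 := by positivity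
    refine le_of_mul_le_mul_left ?_ hn
    nlinarith
  have hsum : b n / √W * (W * (((n : ℝ) + 1) / (4 * C * ‖x‖)))
      ≤ 9 / 5 * (C * (n + 1) * √((n : ℝ) + 1)) := by
    calc b n / √W * (W * (((n : ℝ) + 1) / (4 * C * ‖x‖)))
        ≤ b n / √W * ∑ s ∈ Finset.range (M + 1), 1 / q s ^ 2 *
            ∑ i ∈ Finset.range (M + 1), 1 / b (n - s - i) := by
          rw [hW, Finset.sum_mul]
          gcongr with s hs
          exact hinv s hs
      _ = ∑ i ∈ Finset.range (M + 1),
            b n / √W * ∑ s ∈ Finset.range (M + 1), 1 / q s ^ 2 * (1 / b (n - s - i)) := by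
          rw [← Finset.mul_sum]
          simp only [Finset.mul_sum]
          rw [Finset.sum_comm]
      _ ≤ ∑ i ∈ Finset.range (M + 1), √(∑ j ∈ Finset.range (n + 1), ‖(T ^ i) (v j)‖ ^ 2) :=
          Finset.sum_le_sum hlow
      _ ≤ ∑ i ∈ Finset.range (n + 1), √(∑ j ∈ Finset.range (n + 1), ‖(T ^ i) (v j)‖ ^ 2) :=
          Finset.sum_le_sum_of_subset_of_nonneg (Finset.range_mono (by omega))
            fun _ _ _ => by positivity
      _ ≤ _ := hmain
  have e : b n / √W * (W * (((n : ℝ) + 1) / (4 * C * ‖x‖)))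
      = b n * √W * (((n : ℝ) + 1) / (4 * C * ‖x‖)) := by
    have hw : 0 < √W := Real.sqrt_pos.2 hW0
    nth_rewrite 2 [← Real.mul_self_sqrt hW0.le]
    field_simp
  rw [e, mul_div_assoc', div_le_iff₀ (by positivity)] at hsum
  have hn : (0 : ℝ) < n + 1 := by positivity
  refine le_of_mul_le_mul_right ?_ hn
  calc b n * √W * (n + 1) ≤ _ := hsum
    _ = _ := by ring

theorem norm_pow_mul_sqrt_le (hC : 0 < C)
    (hT : ∀ (x : H) (n : ℕ), ∑ i ∈ Finset.range (n + 1), ‖(T ^ i) x‖ ≤ C * (n + 1) * ‖x‖)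
    {q : ℕ → ℝ} (hq : ∀ s, 0 < q s) (hTq : ∀ s, ‖T ^ s‖ ≤ q s) (n : ℕ) :
    ‖T ^ n‖ * √(∑ s ∈ Finset.range (n / 2 + 1), 1 / q s ^ 2)
      ≤ 36 / 5 * C ^ 2 * √((n : ℝ) + 1) := by
  have hW0 : 0 < √(∑ s ∈ Finset.range (n / 2 + 1), 1 / q s ^ 2) :=
    Real.sqrt_pos.2 (Finset.sum_pos (fun s _ => by have := hq s; positivity) ⟨0, by simp⟩)
  rw [← le_div_iff₀ hW0]
  refine ContinuousLinearMap.opNorm_le_bound _ (by positivity) fun x => ?_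
  rw [div_mul_eq_mul_div, le_div_iff₀ hW0]
  exact norm_pow_apply_mul_sqrt_le hC hT hq hTq n x

theorem norm_pow_le_sqrt (hC : 0 < C)
    (hT : ∀ (x : H) (n : ℕ), ∑ i ∈ Finset.range (n + 1), ‖(T ^ i) x‖ ≤ C * (n + 1) * ‖x‖)
    (n : ℕ) : ‖T ^ n‖ ≤ 36 / 5 * C ^ 2 * √((n : ℝ) + 1) := by
  -- Only the term `s = 0` of the sum is needed, so `q 0 = 1`; the summand `+ 1` elsewhere secures
  -- positivity.
  let q : ℕ → ℝ := fun s => if s = 0 then 1 else ‖T ^ s‖ + 1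
  have hq : ∀ s, 0 < q s := fun s => by
    simp only [q]; split_ifs <;> positivity
  have hTq : ∀ s, ‖T ^ s‖ ≤ q s := fun s => by
    simp only [q]
    split_ifs with h
    · subst h
      rw [pow_zero]
      exact ContinuousLinearMap.norm_id_le
    · linarith
  refine le_trans (le_mul_of_one_le_right (norm_nonneg _) ?_) (norm_pow_mul_sqrt_le hC hT hq hTq n)
  rw [Real.one_le_sqrt]
  have := Finset.single_le_sum (f := fun s => 1 / q s ^ 2)
    (fun s _ => by have := hq s; positivity) (Finset.mem_range.2 (Nat.succ_pos (n / 2)))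
  simpa [q] using this

theorem tendsto_norm_pow_div_sqrt (hC : 0 < C)
    (hT : ∀ (x : H) (n : ℕ), ∑ i ∈ Finset.range (n + 1), ‖(T ^ i) x‖ ≤ C * (n + 1) * ‖x‖) :
    Tendsto (fun n : ℕ => ‖T ^ n‖ / √(n : ℝ)) atTop (𝓝 0) := by
  set K := 36 / 5 * C ^ 2 with hK
  have hK0 : 0 < K := by positivity
  -- Second pass with `q s = K √(s + 1)` from `norm_pow_le_sqrt`: `W n` is `K⁻²` times a harmonic
  -- sum.
  set W : ℕ → ℝ := fun n => ∑ s ∈ Finset.range (n / 2 + 1), 1 / (K * √((s : ℝ) + 1)) ^ 2 with hW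
  have hW0 : ∀ n, 0 < W n := fun n => Finset.sum_pos (fun s _ => by positivity) ⟨0, by simp⟩
  have hWtop : Tendsto W atTop atTop := by
    have h := ((Real.tendsto_sum_range_one_div_nat_succ_atTop.comp
      (tendsto_add_atTop_nat 1)).comp (Nat.tendsto_div_const_atTop two_ne_zero)).const_mul_atTop
      (show 0 < 1 / K ^ 2 by positivity)
    refine h.congr fun n => ?_
    simp only [hW, Function.comp_apply, Finset.mul_sum]
    refine Finset.sum_congr rfl fun s _ => ?_
    rw [mul_pow K, Real.sq_sqrt (by positivity), one_div_mul_one_div]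
  have hlim := (Real.tendsto_sqrt_atTop.comp hWtop).const_div_atTop (K * √2)
  refine squeeze_zero' (Eventually.of_forall fun n => by positivity) ?_ hlim
  filter_upwards [eventually_ge_atTop 1] with n hn
  have hn' : (1 : ℝ) ≤ n := by exact_mod_cast hn
  have h1 := norm_pow_mul_sqrt_le hC hT (q := fun s => K * √((s : ℝ) + 1))
    (fun s => by positivity) (fun s => norm_pow_le_sqrt hC hT s) n
  rw [Function.comp_apply, div_le_div_iff₀ (Real.sqrt_pos.2 (by linarith))
    (Real.sqrt_pos.2 (hW0 n))]
  calc _ ≤ _ := h1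
    _ ≤ K * √(2 * n) := by gcongr; linarith
    _ = _ := by rw [Real.sqrt_mul (by norm_num)]; ring

end Hilbert

theorem corollary2p10 {H : Type*} [NormedAddCommGroup H] [InnerProductSpace ℂ H] [CompleteSpace H]
    (α : ℝ) (hα0 : 0 < α) (hα1 : α ≤ 1) (T : H →L[ℂ] H) (hT : IsAbsolutelyCesaroBounded α T) :
    Tendsto (fun n : ℕ => ‖T ^ n‖ / (n : ℝ) ^ (min α (1 / 2))) atTop (𝓝 0) := by
  obtain ⟨C, hC, h⟩ := hT
  have hsum := sum_cesaroKernel_mul_norm_le hα0 h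
  rcases le_total α (1 / 2) with hα | hα
  · rw [min_eq_left hα]
    exact tendsto_norm_pow_div_rpow hα0 hα1 hC hsum
  · rw [min_eq_right hα]
    simp only [← Real.sqrt_eq_rpow]
    exact tendsto_norm_pow_div_sqrt (div_pos hC hα0) (sum_norm_pow_apply_le hα0 hα1 hC hsum)
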